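/- For $R>1$ let $$T_R=\{((R+\cos v)\cos u,\ (R+\cos v)\sin u,\ \sin v): u,v\in[0,2\pi]\}\subset\mathbb R^3,$$ and for $p\in\mathbb R^3\setminus T_R$ let $i_p$ be the inversion in the unit sphere centred at $p$. Two point sets in $\mathbb R^3$ are called homothetic, or of the same shape, if a similarity of $\mathbb R^3$ (a uniform scaling composed with a Euclidean isometry) carries one onto the other. For $\varrho>0$ let $\mathcal C(\varrho;R)$ be the circle in the $(\rho,z)$-plane with a diameter joining $(\varrho,0)$ and $((R^2-1)/\varrho,0)$ (a single point if $\varrho=\sqrt{R^2-1}$), let $\mathcal C(0;R)$ be the $z$-axis $\{\rho=0\}$, and let $\mathcal T(\varrho;R)=\{(\rho\cos\theta,\rho\sin\theta,z):(\rho,z)\in\mathcal C(\varrho;R),\ \theta\in[0,2\pi]\}$. For real $\varrho\ge 0$ with $\varrho\ne R\pm1$, let $i_\varrho(T_R)$ denote the shape of $i_{(\varrho,0,0)}(T_R)$. Let $\mathrm{M\ddot ob}(3)$ be the group of transformations of $\mathbb R^3\cup\{\infty\}$ generated by similarities and sphere inversions. **Theorem.** Let $R>1$. 1. For every real $\varrho\ge0$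 with $\varrho\neq R\pm1$, all the surfaces $i_p(T_R)$ with $p\in\mathcal T(\varrho;R)$ have the same shape $i_\varrho(T_R)$. 2. The shapes $i_\varrho(T_R)$, $\varrho\in[0,R-1)$, are pairwise distinct. 3. If $R\neq\sqrt2$, the shapes $i_\varrho(T_R)$, $\varrho\in[0,R-1)\cup(R-1,\sqrt{R^2-1}]$, are pairwise distinct. 4. If $R=\sqrt2$, then for every real $\varrho>\sqrt2-1$ with $\varrho\ne\sqrt2+1$ the shape $i_\varrho(T_{\sqrt2})$ is one of the shapes $i_{\varrho'}(T_{\sqrt2})$ with $\varrho'\in[0,\sqrt2-1)$. Moreover $\varrho\mapsto i_\varrho(T_{\sqrt2})$ is a bijection from $[0,\sqrt2-1)$ onto the set of shapes of the surfaces $i_p(T_{\sqrt2})$, $p\in\mathbb R^3\setminus T_{\sqrt2}$, and this map is also a bijection from $[0,\sqrt2-1)$ onto the set of shapes of all images of $T_{\sqrt2}$ under $\mathrm{M\ddot ob}(3)$ that lie in $\mathbb R^3$ (that is, do not contain $\infty$). -/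

import Mathlib

open Set Real

noncomputable section

/-- Euclidean three-space. -/
abbrev E3 : Type := EuclideanSpace ℝ (Fin 3)

/-- Two point sets are homothetic if a similarity of `ℝ³` (a uniform scaling composed with an
isometry) carries one onto the other. -/
def Homothetic (S S' : Set E3) : Prop := ∃ f : E3 ≃ᵈ E3, f '' S = S'

theorem homothetic_equivalence : Equivalence Homothetic where
  refl S := ⟨DilationEquiv.refl E3, by simp⟩
  symm := by
    rintro S _ ⟨f, rfl⟩
    refine ⟨f.symm, ?_⟩
    rw [← image_comp]
    simp
  trans := by
    rintro S _ _ ⟨f, rfl⟩ ⟨g, rfl⟩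
    exact ⟨f.trans g, by rw [← image_comp]; rfl⟩

/-- Point sets of `ℝ³` up to homothety. -/
def homotheticSetoid : Setoid (Set E3) := ⟨Homothetic, homothetic_equivalence⟩

/-- Euclidean shapes: classes of point sets up to homothety. -/
def Shape : Type := Quotient homotheticSetoid

/-- The Euclidean shape of a point set. -/
def shapeOf (S : Set E3) : Shape := Quotient.mk homotheticSetoid S

/-- The torus of revolution `T_R` about the `z`-axis with major radius `R` and minor radius `1`. -/
def torus (R : ℝ) : Set E3 :=
  {x | ∃ u ∈ Icc 0 (2 * π), ∃ v ∈ Icc 0 (2 * π),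
    x = !₂[(R + cos v) * cos u, (R + cos v) * sin u, sin v]}

/-- The image `i_p(T_R)` of `T_R` under inversion in the unit sphere centred at `p`. -/
def invertedTorus (R : ℝ) (p : E3) : Set E3 := EuclideanGeometry.inversion p 1 '' torus R

/-- The circle `𝒞(ϱ; R)` in the `(ρ, z)`-plane with a diameter from `(ϱ, 0)` to `((R² - 1) / ϱ, 0)`;
for `ϱ = 0` it is the `z`-axis. -/
def meridian (R ϱ : ℝ) : Set (ℝ × ℝ) :=
  if ϱ = 0 then {q | q.1 = 0}
  else {q | (q.1 - (ϱ + (R ^ 2 - 1) / ϱ) / 2) ^ 2 + q.2 ^ 2 = ((ϱ - (R ^ 2 - 1) / ϱ) / 2) ^ 2}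

/-- The torus `𝒯(ϱ; R)` swept out by `𝒞(ϱ; R)` when rotated about the `z`-axis. -/
def centerTorus (R ϱ : ℝ) : Set E3 :=
  {x | ∃ q ∈ meridian R ϱ, ∃ θ ∈ Icc 0 (2 * π), x = !₂[q.1 * cos θ, q.1 * sin θ, q.2]}

/-- The shape `i_ϱ(T_R)`, given by the representative with centre `(ϱ, 0, 0) ∈ 𝒯(ϱ; R)`. -/
def invShape (R ϱ : ℝ) : Shape := shapeOf (invertedTorus R !₂[ϱ, 0, 0])

/-- The shape space `{i_p(T_R) : p ∈ ℝ³ \ T_R} / Hom(3)`. -/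
def inversionShapeSpace (R : ℝ) : Set Shape :=
  {s | ∃ p ∉ torus R, s = shapeOf (invertedTorus R p)}

open Classical in
/-- Inversion in the unit sphere centred at `p`, as a self-map of `ℝ³ ∪ {∞}` exchanging
`p` and `∞`. -/
def extInversionFun (p : E3) : OnePoint E3 → OnePoint E3
  | none => some p
  | some x => if x = p then none else some (EuclideanGeometry.inversion p 1 x)

theorem extInversionFun_involutive (p : E3) : Function.Involutive (extInversionFun p) := by
  rintro (_ | x)
  · simp [extInversionFun]
    rfl
  · by_cases h : x = p
    · simp [extInversionFun, h]
      rfl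
    · have h' : EuclideanGeometry.inversion p 1 x ≠ p := by
        rw [Ne, EuclideanGeometry.inversion_eq_center one_ne_zero]
        exact h
      simp [extInversionFun, h, h', EuclideanGeometry.inversion_inversion p one_ne_zero]
      rfl

/-- The inversion in the unit sphere centred at `p`, as a permutation of `ℝ³ ∪ {∞}`. -/
def extInversion (p : E3) : Equiv.Perm (OnePoint E3) :=
  (extInversionFun_involutive p).toPerm

/-- A similarity of `ℝ³`, extended to `ℝ³ ∪ {∞}` by fixing `∞`. -/
def extSimilarity (f : E3 ≃ᵈ E3) : Equiv.Perm (OnePoint E3) :=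
  f.toHomeomorph.onePointCongr.toEquiv

/-- The Möbius group `Möb(3)`, generated by similarities and sphere inversions. -/
def mobiusGroup : Subgroup (Equiv.Perm (OnePoint E3)) :=
  Subgroup.closure (range extSimilarity ∪ range extInversion)

/-- The shapes of those images of `T_R` under `Möb(3)` that lie in `ℝ³`, that is, avoid `∞`. -/
def mobiusShapeSpace (R : ℝ) : Set Shape :=
  {s | ∃ g ∈ mobiusGroup, ∃ S : Set E3,
    ((↑) : E3 → OnePoint E3) '' S = g '' (((↑) : E3 → OnePoint E3) '' torus R) ∧ s = shapeOf S}

end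

/-! In pentaspherical coordinates `(x, a, b)`, points of `ℝ³ ∪ {∞}` are null lines and Möbius maps
act by Lorentz similarities. There `T_R` is the zero set of `torusForm R` on the null cone. With `k
= R² - 1`, this form is diagonal relative to the Lorentz form: eigenvalue `4R²` on the spacelike
plane `(x₀, x₁)`, `0` on the spacelike plane `(x₂, a - k b)`, and `4k` on the timelike line measured
by the height `a + k b`.

Two surfaces `i_p(T_R)`, `i_q(T_R)` are homothetic exactly when a Lorentz similarity preserves the
torus and carries the null line of `p` to that of `q`: conjugating by the two inversions makes it
fix `∞`, hence a similarity. So shapes are orbits of centres under the symmetries of `T_R`.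
Rotations in the two planes act transitively on each level of `torusForm / height²`
(`exists_torusRotation`), and `𝒯(ϱ; R)` lies in one level.

Conversely, a Lorentz similarity preserving the torus must permute the eigenspaces
(`IsLorentzSimilarity.torusForm_torusHeight`). The quadratic equations satisfied by a product of two
circles show that either it fixes both planes, so the level is invariant, or it exchanges them. An
exchange forces `R² = 2` and negates the level; `torusSwap` realises it. On the `x`-axis the level
is injective on `[0, √(R² - 1)]` and negative on `[0, R - 1)`. For `R = √2` the swap moves every
positive level to a negative one. -/

noncomputable section

/-! ### The null cone model of `ℝ³ ∪ {∞}` -/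

/-- The space `ℝ³ × ℝ × ℝ` of pentaspherical coordinates: the points of `ℝ³ ∪ {∞}` are the null
lines of `lorentzForm`. -/
abbrev LorentzSpace : Type := E3 × ℝ × ℝ

/-- The Lorentz form `⟨x, x'⟩ - (a b' + b a') / 2`. -/
def lorentzForm : LorentzSpace →ₗ[ℝ] LorentzSpace →ₗ[ℝ] ℝ :=
  LinearMap.mk₂ ℝ (fun v w => v.1 0 * w.1 0 + v.1 1 * w.1 1 + v.1 2 * w.1 2
      - (v.2.1 * w.2.2 + v.2.2 * w.2.1) / 2)
    (by intros; simp; ring) (by intros; simp; ring) (by intros; simp; ring) (by intros; simp; ring)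

theorem lorentzForm_apply (v w : LorentzSpace) :
    lorentzForm v w = v.1 0 * w.1 0 + v.1 1 * w.1 1 + v.1 2 * w.1 2
      - (v.2.1 * w.2.2 + v.2.2 * w.2.1) / 2 := rfl

/-- The quadratic form cutting the torus `T_R` out of the null cone. -/
def torusForm (R : ℝ) : LorentzSpace →ₗ[ℝ] LorentzSpace →ₗ[ℝ] ℝ :=
  LinearMap.mk₂ ℝ (fun v w => 4 * R ^ 2 * (v.1 0 * w.1 0 + v.1 1 * w.1 1)
      - (v.2.1 + (R ^ 2 - 1) * v.2.2) * (w.2.1 + (R ^ 2 - 1) * w.2.2))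
    (by intros; simp; ring) (by intros; simp; ring) (by intros; simp; ring) (by intros; simp; ring)

theorem torusForm_apply (R : ℝ) (v w : LorentzSpace) :
    torusForm R v w = 4 * R ^ 2 * (v.1 0 * w.1 0 + v.1 1 * w.1 1)
      - (v.2.1 + (R ^ 2 - 1) * v.2.2) * (w.2.1 + (R ^ 2 - 1) * w.2.2) := rfl

theorem E3.ext {x y : E3} (h0 : x 0 = y 0) (h1 : x 1 = y 1) (h2 : x 2 = y 2) : x = y := by
  ext i
  fin_cases i <;> assumption

theorem LorentzSpace.ext {v w : LorentzSpace} (h0 : v.1 0 = w.1 0) (h1 : v.1 1 = w.1 1)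
    (h2 : v.1 2 = w.1 2) (h3 : v.2.1 = w.2.1) (h4 : v.2.2 = w.2.2) : v = w :=
  Prod.ext (E3.ext h0 h1 h2) (Prod.ext h3 h4)

theorem E3.norm_sq (x : E3) : ‖x‖ ^ 2 = x 0 ^ 2 + x 1 ^ 2 + x 2 ^ 2 := by
  simp [EuclideanSpace.norm_sq_eq, Fin.sum_univ_three]

theorem E3.dist_sq (x y : E3) :
    dist x y ^ 2 = (x 0 - y 0) ^ 2 + (x 1 - y 1) ^ 2 + (x 2 - y 2) ^ 2 := by
  simp [dist_eq_norm, E3.norm_sq]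

/-- The null vector over a point of `ℝ³`. -/
def nullLift (x : E3) : LorentzSpace := (x, x 0 ^ 2 + x 1 ^ 2 + x 2 ^ 2, 1)

/-- The null vector over `∞`. -/
def nullInfty : LorentzSpace := (0, 1, 0)

theorem lorentzForm_nullLift (x y : E3) :
    lorentzForm (nullLift x) (nullLift y) = -dist x y ^ 2 / 2 := by
  simp only [lorentzForm_apply, nullLift, E3.dist_sq]
  ring

theorem lorentzForm_nullLift_self (x : E3) : lorentzForm (nullLift x) (nullLift x) = 0 := by
  simp [lorentzForm_nullLift]

theorem lorentzForm_nullInfty (v : LorentzSpace) : lorentzForm v nullInfty = -v.2.2 / 2 := by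
  simp [lorentzForm_apply, nullInfty]
  ring

theorem eq_smul_nullLift {v : LorentzSpace} (hv : lorentzForm v v = 0) (hb : v.2.2 ≠ 0) :
    v = v.2.2 • nullLift (v.2.2⁻¹ • v.1) := by
  rw [lorentzForm_apply] at hv
  apply LorentzSpace.ext <;> simp [nullLift] <;> field_simp
  linarith

theorem eq_smul_nullInfty {v : LorentzSpace} (hv : lorentzForm v v = 0) (hb : v.2.2 = 0) :
    v = v.2.1 • nullInfty := by
  rw [lorentzForm_apply, hb] at hv
  have h0 : v.1 0 = 0 := by nlinarith [sq_nonneg (v.1 1), sq_nonneg (v.1 2), sq_nonneg (v.1 0)]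
  have h1 : v.1 1 = 0 := by nlinarith [sq_nonneg (v.1 1), sq_nonneg (v.1 2), sq_nonneg (v.1 0)]
  have h2 : v.1 2 = 0 := by nlinarith [sq_nonneg (v.1 1), sq_nonneg (v.1 2), sq_nonneg (v.1 0)]
  apply LorentzSpace.ext <;> simp [nullInfty, h0, h1, h2, hb]

theorem nullLift_injective_of_smul {x y : E3} {m : ℝ} (h : nullLift x = m • nullLift y) :
    x = y := by
  have hm : 1 = m := by simpa [nullLift] using congrArg (fun v => v.2.2) h
  subst hm
  simpa [nullLift] using congrArg Prod.fst h

theorem lorentzForm_nondegenerate {v : LorentzSpace} (h : ∀ w, lorentzForm v w = 0) : v = 0 := by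
  have h0 := h (!₂[1, 0, 0], 0, 0)
  have h1 := h (!₂[0, 1, 0], 0, 0)
  have h2 := h (!₂[0, 0, 1], 0, 0)
  have h3 := h (0, 0, 1)
  have h4 := h (0, 1, 0)
  simp [lorentzForm_apply] at h0 h1 h2 h3 h4
  exact LorentzSpace.ext h0 h1 h2 h3 h4

/-! ### Lorentz similarities, dilations and inversions -/

/-- A linear map scaling the Lorentz form by a positive factor. -/
def IsLorentzSimilarity (L : LorentzSpace →ₗ[ℝ] LorentzSpace) (μ : ℝ) : Prop :=
  0 < μ ∧ ∀ v w, lorentzForm (L v) (L w) = μ * lorentzForm v w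

namespace IsLorentzSimilarity

variable {L M : LorentzSpace →ₗ[ℝ] LorentzSpace} {μ ν : ℝ}

theorem comp (hL : IsLorentzSimilarity L μ) (hM : IsLorentzSimilarity M ν) :
    IsLorentzSimilarity (L ∘ₗ M) (μ * ν) :=
  ⟨mul_pos hL.1 hM.1, fun v w => by simp [hL.2, hM.2, mul_assoc]⟩

theorem injective (hL : IsLorentzSimilarity L μ) : Function.Injective L := by
  rw [← LinearMap.ker_eq_bot, LinearMap.ker_eq_bot']
  intro v hv
  refine lorentzForm_nondegenerate fun w => ?_
  have := hL.2 v w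
  rw [hv] at this
  simpa [hL.1.ne'] using this.symm

theorem surjective (hL : IsLorentzSimilarity L μ) : Function.Surjective L :=
  LinearMap.injective_iff_surjective.1 hL.injective

/-- Pairing with `nullInfty` reads off the last coordinate, so fixing the null line of `∞` makes `L`
rescale that coordinate by a constant. All lifts of points are then rescaled by this same constant,
and since the pairing of two lifts is `-dist² / 2`, the induced point map multiplies distances by a
constant. -/
theorem exists_dilation (hL : IsLorentzSimilarity L μ) {m : ℝ}
    (hm : L nullInfty = m • nullInfty) :
    ∃ f : E3 ≃ᵈ E3, ∃ c : ℝ, c ≠ 0 ∧ ∀ x, L (nullLift x) = c • nullLift (f x) := by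
  have hμ := hL.1
  have hm0 : m ≠ 0 := by
    rintro rfl
    have := hL.injective (a₁ := nullInfty) (a₂ := 0) (by simp [hm])
    simpa [nullInfty] using congrArg (fun v => v.2.1) this
  have hb : ∀ v, (L v).2.2 = μ / m * v.2.2 := by
    intro v
    have := hL.2 v nullInfty
    rw [hm, map_smul, smul_eq_mul, lorentzForm_nullInfty, lorentzForm_nullInfty] at this
    field_simp
    linarith
  have hc : μ / m ≠ 0 := div_ne_zero hμ.ne' hm0
  set c := μ / m with hcdef
  let g : E3 → E3 := fun x => c⁻¹ • (L (nullLift x)).1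
  have hg : ∀ x, L (nullLift x) = c • nullLift (g x) := by
    intro x
    have h2 : (L (nullLift x)).2.2 = c := by simp [hb, nullLift]
    have := eq_smul_nullLift (v := L (nullLift x))
      (by rw [hL.2, lorentzForm_nullLift_self, mul_zero]) (by rwa [h2])
    rwa [h2] at this
  have hd : ∀ x y, dist (g x) (g y) = √μ / |c| * dist x y := by
    intro x y
    have := hL.2 (nullLift x) (nullLift y)
    rw [hg, hg] at this
    simp only [map_smul, LinearMap.smul_apply, smul_eq_mul, lorentzForm_nullLift] at this
    have h2 : dist (g x) (g y) ^ 2 = (√μ / |c| * dist x y) ^ 2 := by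
      rw [mul_pow, div_pow, sq_sqrt hμ.le, sq_abs]
      field_simp
      linarith
    exact (pow_left_inj₀ dist_nonneg (by positivity) two_ne_zero).1 h2
  have hr : 0 < √μ / |c| := by positivity
  have hsurj : Function.Surjective g := by
    intro y
    obtain ⟨v, hv⟩ := hL.surjective (nullLift y)
    have hv0 : lorentzForm v v = 0 := by
      have := hL.2 v v
      rw [hv, lorentzForm_nullLift_self] at this
      simpa [hμ.ne'] using this.symm
    have hvb : v.2.2 ≠ 0 := by
      intro h0
      have := hb v
      rw [hv, h0] at this
      simp [nullLift] at this
    refine ⟨v.2.2⁻¹ • v.1, ?_⟩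
    have h3 := eq_smul_nullLift hv0 hvb
    rw [h3, map_smul, hg, smul_smul] at hv
    exact (nullLift_injective_of_smul hv.symm).symm
  have hinj : Function.Injective g := by
    intro x y hxy
    have := hd x y
    rw [hxy, dist_self] at this
    exact dist_eq_zero.1 ((mul_eq_zero.1 this.symm).resolve_left hr.ne')
  let K : NNReal := ⟨√μ / |c|, hr.le⟩
  have hK : ∀ x y, edist (g x) (g y) = K * edist x y := by
    intro x y
    rw [edist_nndist, edist_nndist, ← ENNReal.coe_mul, ENNReal.coe_inj]
    exact NNReal.eq (hd x y)
  exact ⟨DilationEquiv.mk (Equiv.ofBijective g ⟨hinj, hsurj⟩)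
    ⟨K, fun h => hr.ne' (congrArg NNReal.toReal h), hK⟩, c, hc, hg⟩

end IsLorentzSimilarity

/-- The linear map inducing a dilation. -/
theorem exists_lorentz_of_dilation (f : E3 ≃ᵈ E3) :
    ∃ L μ, IsLorentzSimilarity L μ ∧ (∀ x, L (nullLift x) = nullLift (f x)) ∧
      L nullInfty = μ • nullInfty := by
  obtain ⟨r, hr0, hr⟩ := f.edist_eq'
  have hr' : (r : ℝ) ≠ 0 := by exact_mod_cast hr0
  have hd : ∀ x y, dist (f x) (f y) = r * dist x y := by
    intro x y
    have := hr x y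
    rw [edist_nndist, edist_nndist, ← ENNReal.coe_mul, ENNReal.coe_inj] at this
    exact congrArg NNReal.toReal this
  let e : E3 ≃ᵢ E3 := IsometryEquiv.mk' (fun x => (r : ℝ)⁻¹ • (f x - f 0))
    (fun y => f.symm ((r : ℝ) • y + f 0)) (fun y => by simp [smul_smul, hr'])
    (Isometry.of_dist_eq fun x y => by
      rw [dist_smul₀, dist_sub_right, hd, Real.norm_eq_abs, abs_inv, NNReal.abs_eq]
      field_simp)
  -- By Mazur–Ulam, the normalised dilation is linear, whence `f = r U + t`.
  let U : E3 ≃ₗᵢ[ℝ] E3 := e.toRealLinearIsometryEquivOfMapZero (by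
    change (r : ℝ)⁻¹ • (f 0 - f 0) = 0
    simp)
  have hU : ∀ x, f x = (r : ℝ) • U x + f 0 := by
    intro x
    have : U x = (r : ℝ)⁻¹ • (f x - f 0) := rfl
    simp [this, smul_smul, hr']
  have hin : ∀ x y : E3, x 0 * y 0 + x 1 * y 1 + x 2 * y 2 = inner ℝ x y := by
    intro x y
    simp [PiLp.inner_apply, Fin.sum_univ_three]
    ring
  have hUin := fun x y => (hin (U x) (U y)).trans ((U.inner_map_map x y).trans (hin x y).symm)
  set t := f 0
  let L : LorentzSpace →ₗ[ℝ] LorentzSpace :=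
    { toFun := fun v => ((r : ℝ) • U v.1 + v.2.2 • t,
        r ^ 2 * v.2.1 + 2 * r * (U v.1 0 * t 0 + U v.1 1 * t 1 + U v.1 2 * t 2)
          + v.2.2 * (t 0 ^ 2 + t 1 ^ 2 + t 2 ^ 2), v.2.2)
      map_add' := by
        intro v w
        apply LorentzSpace.ext <;> simp <;> ring
      map_smul' := by
        intro c v
        apply LorentzSpace.ext <;> simp <;> ring }
  refine ⟨L, r ^ 2, ⟨by positivity, fun v w => ?_⟩, fun x => ?_, ?_⟩
  · have := hUin v.1 w.1
    simp only [lorentzForm_apply, L, LinearMap.coe_mk, AddHom.coe_mk, PiLp.add_apply,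
      PiLp.smul_apply, smul_eq_mul]
    linear_combination (r : ℝ) ^ 2 * this
  · have := hUin x x
    apply LorentzSpace.ext <;> simp [nullLift, L, hU x]
    linear_combination -(r : ℝ) ^ 2 * this
  · apply LorentzSpace.ext <;> simp [nullInfty, L]

/-- The linear map inducing the inversion in the unit sphere centred at `p`. -/
def inversionMap (p : E3) : LorentzSpace →ₗ[ℝ] LorentzSpace where
  toFun v :=
    (v.1 + (v.2.1 - 2 * (v.1 0 * p 0 + v.1 1 * p 1 + v.1 2 * p 2)
        + v.2.2 * (p 0 ^ 2 + p 1 ^ 2 + p 2 ^ 2) - v.2.2) • p,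
      v.2.2 + 2 * (v.1 0 * p 0 + v.1 1 * p 1 + v.1 2 * p 2)
        - 2 * v.2.2 * (p 0 ^ 2 + p 1 ^ 2 + p 2 ^ 2)
        + (v.2.1 - 2 * (v.1 0 * p 0 + v.1 1 * p 1 + v.1 2 * p 2)
          + v.2.2 * (p 0 ^ 2 + p 1 ^ 2 + p 2 ^ 2)) * (p 0 ^ 2 + p 1 ^ 2 + p 2 ^ 2),
      v.2.1 - 2 * (v.1 0 * p 0 + v.1 1 * p 1 + v.1 2 * p 2)
        + v.2.2 * (p 0 ^ 2 + p 1 ^ 2 + p 2 ^ 2))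
  map_add' v w := by apply LorentzSpace.ext <;> simp <;> ring
  map_smul' c v := by apply LorentzSpace.ext <;> simp <;> ring

/-- `inversionMap p` is the Lorentz reflection along the unit spacelike vector `(p, |p|² - 1, 1)`
representing the sphere. -/
theorem isLorentzSimilarity_inversionMap (p : E3) : IsLorentzSimilarity (inversionMap p) 1 := by
  refine ⟨one_pos, fun v w => ?_⟩
  simp only [lorentzForm_apply, inversionMap, LinearMap.coe_mk, AddHom.coe_mk, PiLp.add_apply,
      PiLp.smul_apply, smul_eq_mul]
  ring

theorem inversionMap_inversionMap (p : E3) (v : LorentzSpace) :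
    inversionMap p (inversionMap p v) = v := by
  apply LorentzSpace.ext <;>
    simp only [inversionMap, LinearMap.coe_mk, AddHom.coe_mk, PiLp.add_apply,
      PiLp.smul_apply, smul_eq_mul] <;> ring

theorem inversionMap_nullInfty (p : E3) : inversionMap p nullInfty = nullLift p := by
  apply LorentzSpace.ext <;> simp [inversionMap, nullInfty, nullLift]

theorem inversionMap_nullLift_self (p : E3) : inversionMap p (nullLift p) = nullInfty := by
  rw [← inversionMap_nullInfty, inversionMap_inversionMap]

theorem inversionMap_nullLift (p x : E3) (h : x ≠ p) :
    inversionMap p (nullLift x) =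
      dist x p ^ 2 • nullLift (EuclideanGeometry.inversion p 1 x) := by
  have hd : dist x p ≠ 0 := dist_ne_zero.2 h
  have key := E3.dist_sq x p
  apply LorentzSpace.ext <;>
    simp [inversionMap, nullLift, EuclideanGeometry.inversion] <;>
    field_simp <;> rw [key] <;> ring

/-! ### The torus as a quadric section of the null cone -/

theorem shapeOf_eq_iff {S S' : Set E3} : shapeOf S = shapeOf S' ↔ Homothetic S S' :=
  Quotient.eq

theorem exists_angle {a b : ℝ} (h : a ^ 2 + b ^ 2 = 1) :
    ∃ t ∈ Icc 0 (2 * π), cos t = a ∧ sin t = b := by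
  have ha1 : -1 ≤ a := by nlinarith
  have ha2 : a ≤ 1 := by nlinarith
  have hs : 1 - a ^ 2 = b ^ 2 := by linarith
  have h0 := arccos_nonneg a
  have hpi := arccos_le_pi a
  rcases le_total 0 b with hb | hb
  · exact ⟨arccos a, ⟨h0, by linarith [pi_pos]⟩, cos_arccos ha1 ha2, by
      rw [sin_arccos, hs, sqrt_sq hb]⟩
  · exact ⟨2 * π - arccos a, ⟨by linarith, by linarith⟩, by
      rw [cos_two_pi_sub, cos_arccos ha1 ha2], by
      rw [sin_two_pi_sub, sin_arccos, hs, sqrt_sq_eq_abs, abs_of_nonpos hb, neg_neg]⟩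

/-- The torus equation is `2 R ρ = |x|² + R² - 1` with `ρ` the distance to the `z`-axis. Both sides
are nonnegative as `R > 1`, so squaring loses nothing. -/
theorem mem_torus_iff {R : ℝ} (hR : 1 < R) (x : E3) :
    x ∈ torus R ↔ torusForm R (nullLift x) (nullLift x) = 0 := by
  simp only [torusForm_apply, nullLift]
  constructor
  · rintro ⟨u, -, v, -, rfl⟩
    have hu := sin_sq_add_cos_sq u
    have hv := sin_sq_add_cos_sq v
    have h1 : ((R + cos v) * cos u) ^ 2 + ((R + cos v) * sin u) ^ 2 = (R + cos v) ^ 2 := by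
      linear_combination (R + cos v) ^ 2 * hu
    have h2 : ((R + cos v) * cos u) ^ 2 + ((R + cos v) * sin u) ^ 2 + sin v ^ 2 + (R ^ 2 - 1) * 1
        = 2 * R * (R + cos v) := by
      linear_combination h1 + hv
    simp only [Matrix.cons_val_zero, Matrix.cons_val_one, Matrix.cons_val]
    rw [h2]
    linear_combination 4 * R ^ 2 * h1
  · intro h
    set ρ := √(x 0 ^ 2 + x 1 ^ 2) with hρ
    have hρ2 : ρ ^ 2 = x 0 ^ 2 + x 1 ^ 2 := sq_sqrt (by positivity)
    have hρ0 : 0 ≤ ρ := sqrt_nonneg _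
    have hpos : 0 < x 0 ^ 2 + x 1 ^ 2 + x 2 ^ 2 + (R ^ 2 - 1) := by
      nlinarith [sq_nonneg (x 0), sq_nonneg (x 1), sq_nonneg (x 2)]
    have h1 : 2 * R * ρ = x 0 ^ 2 + x 1 ^ 2 + x 2 ^ 2 + (R ^ 2 - 1) := by
      refine (pow_left_inj₀ (by positivity) hpos.le two_ne_zero).1 ?_
      linear_combination h + 4 * R ^ 2 * hρ2
    have hρ1 : ρ ≠ 0 := by
      intro h0
      rw [h0] at h1
      linarith
    obtain ⟨v, hv, hcv, hsv⟩ := exists_angle (a := ρ - R) (b := x 2)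
      (by linear_combination hρ2 - h1)
    obtain ⟨u, hu, hcu, hsu⟩ := exists_angle (a := x 0 / ρ) (b := x 1 / ρ)
      (by field_simp; linarith)
    refine ⟨u, hu, v, hv, ?_⟩
    rw [hcv, hcu, hsu, hsv]
    apply E3.ext <;> simp <;> field_simp

theorem mem_invertedTorus_iff {R : ℝ} (hR : 1 < R) {p : E3} (hp : p ∉ torus R) (y : E3) :
    y ∈ invertedTorus R p ↔
      torusForm R (inversionMap p (nullLift y)) (inversionMap p (nullLift y)) = 0 := by
  by_cases h : y = p
  · subst h
    -- The centre corresponds to `∞`, where `torusForm` equals `-1`, so neither side holds.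
    rw [inversionMap_nullLift_self]
    constructor
    · rintro ⟨x, hx, hxy⟩
      rw [EuclideanGeometry.inversion_eq_center one_ne_zero] at hxy
      exact (hp (hxy ▸ hx)).elim
    · simp [torusForm_apply, nullInfty]
  · have hd : dist y p ≠ 0 := dist_ne_zero.2 h
    rw [inversionMap_nullLift p y h]
    simp only [map_smul, LinearMap.smul_apply, smul_eq_mul]
    rw [invertedTorus, mul_eq_zero_iff_left (pow_ne_zero 2 hd),
      mul_eq_zero_iff_left (pow_ne_zero 2 hd), ← mem_torus_iff hR]
    constructor
    · rintro ⟨x, hx, rfl⟩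
      rwa [EuclideanGeometry.inversion_inversion p one_ne_zero]
    · exact fun hx => ⟨_, hx, EuclideanGeometry.inversion_inversion p one_ne_zero y⟩

/-- A Lorentz similarity preserving the torus and carrying `p` to `q` makes the surfaces inverted
in `p` and `q` homothetic. -/
theorem shapeOf_invertedTorus_eq {R : ℝ} (hR : 1 < R) {p q : E3} (hp : p ∉ torus R)
    (hq : q ∉ torus R) {L : LorentzSpace →ₗ[ℝ] LorentzSpace} {μ m : ℝ}
    (hL : IsLorentzSimilarity L μ) (hLp : L (nullLift p) = m • nullLift q)
    (hT : ∀ v, lorentzForm v v = 0 → (torusForm R (L v) (L v) = 0 ↔ torusForm R v v = 0)) :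
    shapeOf (invertedTorus R p) = shapeOf (invertedTorus R q) := by
  -- The conjugate by the inversions at `p` and `q` sends `∞` to `p` to `q` to `∞`.
  obtain ⟨f, c, hc, hf⟩ := IsLorentzSimilarity.exists_dilation
    ((isLorentzSimilarity_inversionMap q).comp (hL.comp (isLorentzSimilarity_inversionMap p)))
    (m := m) (by simp [inversionMap_nullInfty, hLp, inversionMap_nullLift_self])
  rw [shapeOf_eq_iff]
  have key : ∀ y, f y ∈ invertedTorus R q ↔ y ∈ invertedTorus R p := by
    intro y
    rw [mem_invertedTorus_iff hR hp, mem_invertedTorus_iff hR hq, ← hT (inversionMap p (nullLift y)) (by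
      rw [(isLorentzSimilarity_inversionMap p).2, lorentzForm_nullLift_self, mul_zero])]
    have h1 : L (inversionMap p (nullLift y)) = c • inversionMap q (nullLift (f y)) := by
      rw [← map_smul, ← hf]
      simp [inversionMap_inversionMap]
    rw [h1]
    simp [hc]
  refine ⟨f, ?_⟩
  ext y
  constructor
  · rintro ⟨x, hx, rfl⟩
    exact (key x).2 hx
  · intro hy
    refine ⟨f.symm y, (key _).1 ?_, ?_⟩ <;> simp [hy]

/-! ### Symmetries of the torus -/

theorem exists_rotation {x y x' y' : ℝ} (h : x ^ 2 + y ^ 2 = x' ^ 2 + y' ^ 2) :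
    ∃ c s : ℝ, c ^ 2 + s ^ 2 = 1 ∧ c * x + s * y = x' ∧ c * y - s * x = y' := by
  by_cases h0 : x ^ 2 + y ^ 2 = 0
  · have hx : x = 0 := by nlinarith [sq_nonneg x, sq_nonneg y]
    have hy : y = 0 := by nlinarith [sq_nonneg x, sq_nonneg y]
    have hx' : x' = 0 := by nlinarith [sq_nonneg x', sq_nonneg y']
    have hy' : y' = 0 := by nlinarith [sq_nonneg x', sq_nonneg y']
    exact ⟨1, 0, by simp [*]⟩
  -- In complex notation `c - i s = (x' + i y') / (x + i y)`.
  · refine ⟨(x * x' + y * y') / (x ^ 2 + y ^ 2), (x' * y - x * y') / (x ^ 2 + y ^ 2), ?_, ?_, ?_⟩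
    · field_simp
      linear_combination -(x ^ 2 + y ^ 2) * h
    · field_simp
      ring
    · field_simp
      ring

/-- The rotations of `ℝ³ ∪ {∞}` preserving `T_R`, with `κ ^ 2 = R ^ 2 - 1`: one about the
`z`-axis, and one about the circle `{z = 0, ρ = κ}`. -/
def torusRotation (κ c s c' s' : ℝ) : LorentzSpace →ₗ[ℝ] LorentzSpace where
  toFun v :=
    (!₂[c * v.1 0 + s * v.1 1, c * v.1 1 - s * v.1 0,
        c' * v.1 2 + s' * ((v.2.1 - κ ^ 2 * v.2.2) / (2 * κ))],
      (v.2.1 + κ ^ 2 * v.2.2) / 2 + κ * (c' * ((v.2.1 - κ ^ 2 * v.2.2) / (2 * κ)) - s' * v.1 2),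
      ((v.2.1 + κ ^ 2 * v.2.2) / 2
        - κ * (c' * ((v.2.1 - κ ^ 2 * v.2.2) / (2 * κ)) - s' * v.1 2)) / κ ^ 2)
  map_add' v w := by apply LorentzSpace.ext <;> simp <;> ring
  map_smul' c v := by apply LorentzSpace.ext <;> simp <;> ring

/-- The involution of `ℝ³ ∪ {∞}` preserving `T_{√2}` and swapping its sides. -/
def torusSwap : LorentzSpace →ₗ[ℝ] LorentzSpace where
  toFun v :=
    (!₂[v.1 2, (v.2.1 - v.2.2) / 2, v.1 0],
      (v.2.1 + v.2.2) / 2 + v.1 1, (v.2.1 + v.2.2) / 2 - v.1 1)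
  map_add' v w := by apply LorentzSpace.ext <;> simp <;> ring
  map_smul' c v := by apply LorentzSpace.ext <;> simp <;> ring

theorem isLorentzSimilarity_torusRotation {κ c s c' s' : ℝ} (hκ : κ ≠ 0)
    (h : c ^ 2 + s ^ 2 = 1) (h' : c' ^ 2 + s' ^ 2 = 1) :
    IsLorentzSimilarity (torusRotation κ c s c' s') 1 := by
  refine ⟨one_pos, fun v w => ?_⟩
  have e1 : c ^ 2 = 1 - s ^ 2 := by linarith
  have e2 : c' ^ 2 = 1 - s' ^ 2 := by linarith
  simp [lorentzForm_apply, torusRotation]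
  field_simp
  ring_nf
  simp only [e1, e2]
  ring

theorem isLorentzSimilarity_torusSwap : IsLorentzSimilarity torusSwap 1 := by
  refine ⟨one_pos, fun v w => ?_⟩
  simp [lorentzForm_apply, torusSwap]
  ring

theorem torusForm_torusRotation {R κ c s c' s' : ℝ} (hκ : κ ≠ 0) (hk : κ ^ 2 = R ^ 2 - 1)
    (h : c ^ 2 + s ^ 2 = 1) (v : LorentzSpace) :
    torusForm R (torusRotation κ c s c' s' v) (torusRotation κ c s c' s' v) =
      torusForm R v v := by
  simp [torusForm_apply, torusRotation]
  rw [← hk]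
  field_simp
  linear_combination 16 * R ^ 2 * (v.1 0 ^ 2 + v.1 1 ^ 2) * h

/-- For `R² = 2` the eigenvalues are `8`, `0` and, on the timelike line, their midpoint `4`.
Exchanging the two planes therefore replaces each eigenvalue `l` by `8 - l`; on null vectors this
changes the sign of the form. -/
theorem torusForm_torusSwap (v : LorentzSpace) :
    torusForm √2 (torusSwap v) (torusSwap v) = 8 * lorentzForm v v - torusForm √2 v v := by
  have h2 : √2 ^ 2 = 2 := sq_sqrt zero_le_two
  simp [torusForm_apply, lorentzForm_apply, torusSwap]
  ring

/-- The linear form `a + (R ^ 2 - 1) b`, whose square is invariant under the Lorentz similarities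
preserving `T_R` up to scale. -/
def torusHeight (R : ℝ) : LorentzSpace →ₗ[ℝ] ℝ where
  toFun v := v.2.1 + (R ^ 2 - 1) * v.2.2
  map_add' v w := by simp; ring
  map_smul' c v := by simp; ring

theorem torusHeight_apply (R : ℝ) (v : LorentzSpace) :
    torusHeight R v = v.2.1 + (R ^ 2 - 1) * v.2.2 := rfl

theorem torusHeight_nullLift_pos {R : ℝ} (hR : 1 < R) (p : E3) :
    0 < torusHeight R (nullLift p) := by
  simp only [torusHeight_apply, nullLift]
  nlinarith [sq_nonneg (p 0), sq_nonneg (p 1), sq_nonneg (p 2)]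

/-- After scaling to match heights, equal levels give equal lengths in the plane `(x₀, x₁)`, and
nullity then gives equal lengths in the other plane. One rotation in each plane finishes. -/
theorem exists_torusRotation {R κ : ℝ} (hR : 1 < R) (hκ : κ ≠ 0) (hk : κ ^ 2 = R ^ 2 - 1)
    {v : LorentzSpace} (hv : lorentzForm v v = 0) (q : E3)
    (h : torusForm R v v * torusHeight R (nullLift q) ^ 2 =
      torusForm R (nullLift q) (nullLift q) * torusHeight R v ^ 2) :
    ∃ c s c' s' m : ℝ, c ^ 2 + s ^ 2 = 1 ∧ c' ^ 2 + s' ^ 2 = 1 ∧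
      torusRotation κ c s c' s' v = m • nullLift q := by
  have hq := torusHeight_nullLift_pos hR q
  have hqq := lorentzForm_nullLift_self q
  set m := torusHeight R v / torusHeight R (nullLift q) with hm
  have hme : m * torusHeight R (nullLift q) = torusHeight R v := by
    rw [hm]
    field_simp
  have hF : torusForm R v v = m ^ 2 * torusForm R (nullLift q) (nullLift q) := by
    rw [hm]
    field_simp
    linarith
  clear_value m
  clear h hm
  have h1 : v.1 0 ^ 2 + v.1 1 ^ 2 = (m * q 0) ^ 2 + (m * q 1) ^ 2 := by
    have hR0 : (4 * R ^ 2) ≠ 0 := by positivity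
    apply mul_left_cancel₀ hR0
    simp only [torusForm_apply, torusHeight_apply, nullLift] at hF hme
    rw [← hme] at hF
    linear_combination hF
  have h2 : v.1 2 ^ 2 + ((v.2.1 - κ ^ 2 * v.2.2) / (2 * κ)) ^ 2 =
      (m * q 2) ^ 2 + (m * ((q 0 ^ 2 + q 1 ^ 2 + q 2 ^ 2 - κ ^ 2) / (2 * κ))) ^ 2 := by
    simp only [torusHeight_apply, nullLift, ← hk] at hme
    simp only [lorentzForm_apply] at hv
    field_simp
    linear_combination 4 * κ ^ 2 * hv - 4 * κ ^ 2 * h1 - (m * (q 0 ^ 2 + q 1 ^ 2 + q 2 ^ 2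
      + κ ^ 2 * 1) + (v.2.1 + κ ^ 2 * v.2.2)) * hme
  obtain ⟨c, s, hcs, hc1, hc2⟩ := exists_rotation h1
  obtain ⟨c', s', hcs', hc1', hc2'⟩ := exists_rotation h2
  refine ⟨c, s, c', s', m, hcs, hcs', ?_⟩
  simp only [torusHeight_apply, nullLift, ← hk] at hme
  apply LorentzSpace.ext <;> simp only [torusRotation, nullLift, LinearMap.coe_mk, AddHom.coe_mk,
    hc1, hc2, hc1', hc2', ← hme] <;> simp <;> field_simp <;> ring

/-- Centres at the same level of the torus form have homothetic inverted tori. -/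
theorem shapeOf_invertedTorus_eq_of_level {R : ℝ} (hR : 1 < R) {p q : E3} (hp : p ∉ torus R)
    (hq : q ∉ torus R)
    (h : torusForm R (nullLift p) (nullLift p) * torusHeight R (nullLift q) ^ 2 =
      torusForm R (nullLift q) (nullLift q) * torusHeight R (nullLift p) ^ 2) :
    shapeOf (invertedTorus R p) = shapeOf (invertedTorus R q) := by
  have hpos : 0 < R ^ 2 - 1 := by nlinarith
  have hκ : √(R ^ 2 - 1) ≠ 0 := (sqrt_pos.2 hpos).ne'
  have hk : √(R ^ 2 - 1) ^ 2 = R ^ 2 - 1 := sq_sqrt hpos.le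
  obtain ⟨c, s, c', s', m, hcs, hcs', hm⟩ :=
    exists_torusRotation hR hκ hk (lorentzForm_nullLift_self p) q h
  exact shapeOf_invertedTorus_eq hR hp hq (isLorentzSimilarity_torusRotation hκ hcs hcs') hm
    fun v _ => by rw [torusForm_torusRotation hκ hk hcs]

/-- For `R = √2`, centres at opposite levels of the torus form have homothetic inverted tori. -/
theorem shapeOf_invertedTorus_eq_of_opposite_level {p q : E3} (hp : p ∉ torus √2)
    (hq : q ∉ torus √2)
    (h : torusForm √2 (nullLift p) (nullLift p) * torusHeight √2 (nullLift q) ^ 2 =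
      -torusForm √2 (nullLift q) (nullLift q) * torusHeight √2 (nullLift p) ^ 2) :
    shapeOf (invertedTorus √2 p) = shapeOf (invertedTorus √2 q) := by
  have hR : 1 < √2 := one_lt_sqrt_two
  have hk : (1 : ℝ) ^ 2 = √2 ^ 2 - 1 := by
    rw [sq_sqrt zero_le_two]
    norm_num
  have hh : ∀ v, torusHeight √2 (torusSwap v) = torusHeight √2 v := by
    intro v
    simp [torusHeight_apply, torusSwap]
    ring
  obtain ⟨c, s, c', s', m, hcs, hcs', hm⟩ :=
    exists_torusRotation hR one_ne_zero hk (v := torusSwap (nullLift p))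
      (by rw [isLorentzSimilarity_torusSwap.2, lorentzForm_nullLift_self, mul_zero]) q
      (by
        rw [hh, torusForm_torusSwap, lorentzForm_nullLift_self]
        linear_combination -h)
  refine shapeOf_invertedTorus_eq hR hp hq
    ((isLorentzSimilarity_torusRotation one_ne_zero hcs hcs').comp isLorentzSimilarity_torusSwap)
    hm fun v hv => ?_
  rw [LinearMap.comp_apply, torusForm_torusRotation one_ne_zero hk hcs, torusForm_torusSwap, hv]
  simp

/-! ### Rigidity: what a torus-preserving Lorentz similarity can do -/

/-- The only quadratic relations on a product of two unit circles are the combinations of the two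
circle equations, so a form vanishing there has no mixed terms and is constant on each plane. -/
theorem quadratic_coeffs_of_vanishing_on_torus
    {g11 g12 g13 g14 g15 g22 g23 g24 g25 g33 g34 g35 g44 g45 g55 : ℝ}
    (H : ∀ c s c' s' : ℝ, c ^ 2 + s ^ 2 = 1 → c' ^ 2 + s' ^ 2 = 1 →
      c ^ 2 * g11 + s ^ 2 * g22 + c' ^ 2 * g33 + s' ^ 2 * g44 + g55
        + 2 * (c * s * g12 + c * c' * g13 + c * s' * g14 + c * g15 + s * c' * g23 + s * s' * g24
          + s * g25 + c' * s' * g34 + c' * g35 + s' * g45) = 0) :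
    (g12 = 0 ∧ g13 = 0 ∧ g14 = 0 ∧ g15 = 0 ∧ g23 = 0 ∧ g24 = 0 ∧ g25 = 0 ∧ g34 = 0 ∧ g35 = 0 ∧
      g45 = 0) ∧ g11 = g22 ∧ g33 = g44 ∧ g11 + g33 + g55 = 0 := by
  have a1 := H 1 0 1 0 (by norm_num) (by norm_num)
  have a2 := H 1 0 (-1) 0 (by norm_num) (by norm_num)
  have a3 := H (-1) 0 1 0 (by norm_num) (by norm_num)
  have a4 := H (-1) 0 (-1) 0 (by norm_num) (by norm_num)
  have b1 := H 1 0 0 1 (by norm_num) (by norm_num)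
  have b2 := H 1 0 0 (-1) (by norm_num) (by norm_num)
  have b3 := H (-1) 0 0 1 (by norm_num) (by norm_num)
  have b4 := H (-1) 0 0 (-1) (by norm_num) (by norm_num)
  have c1 := H 0 1 1 0 (by norm_num) (by norm_num)
  have c2 := H 0 1 (-1) 0 (by norm_num) (by norm_num)
  have c3 := H 0 (-1) 1 0 (by norm_num) (by norm_num)
  have c4 := H 0 (-1) (-1) 0 (by norm_num) (by norm_num)
  have d1 := H 0 1 0 1 (by norm_num) (by norm_num)
  have d2 := H 0 1 0 (-1) (by norm_num) (by norm_num)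
  have d3 := H 0 (-1) 0 1 (by norm_num) (by norm_num)
  have d4 := H 0 (-1) 0 (-1) (by norm_num) (by norm_num)
  -- At the points with coordinates `0, ±1` the products `c s` and `c' s'` vanish; a Pythagorean
  -- triple in each circle detects `g12` and `g34`.
  have e1 := H (3 / 5) (4 / 5) 1 0 (by norm_num) (by norm_num)
  have e2 := H 1 0 (3 / 5) (4 / 5) (by norm_num) (by norm_num)
  ring_nf at a1 a2 a3 a4 b1 b2 b3 b4 c1 c2 c3 c4 d1 d2 d3 d4 e1 e2
  have h13 : g13 = 0 := by linarith
  have h14 : g14 = 0 := by linarith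
  have h15 : g15 = 0 := by linarith
  have h23 : g23 = 0 := by linarith
  have h24 : g24 = 0 := by linarith
  have h25 : g25 = 0 := by linarith
  have h35 : g35 = 0 := by linarith
  have h45 : g45 = 0 := by linarith
  have h11 : g11 = g22 := by linarith
  have h33 : g33 = g44 := by linarith
  refine ⟨⟨?_, h13, h14, h15, h23, h24, h25, ?_, h35, h45⟩, h11, h33, by linarith⟩
  · subst h13 h15 h23 h25 h35 h11
    linarith
  · subst h13 h14 h15 h35 h45 h33
    linarith

/-- The eigenspaces for `0` and `4R²` are spacelike and that for `4(R² - 1)` is a timelike line, so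
the sign of `lorentzForm u u` limits the eigenvalue. -/
theorem torusForm_eigenvector {R l : ℝ} (hR : 1 < R) {u : LorentzSpace}
    (h : ∀ w, torusForm R u w = l * lorentzForm u w) :
    (0 < lorentzForm u u → l = 0 ∨ l = 4 * R ^ 2) ∧
      (lorentzForm u u < 0 →
        l = 4 * (R ^ 2 - 1) ∧ u.1 0 = 0 ∧ u.1 1 = 0 ∧ u.1 2 = 0 ∧
          u.2.1 = (R ^ 2 - 1) * u.2.2) := by
  have hk : 0 < R ^ 2 - 1 := by nlinarith
  have h0 := h (!₂[1, 0, 0], 0, 0)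
  have h1 := h (!₂[0, 1, 0], 0, 0)
  have h2 := h (!₂[0, 0, 1], 0, 0)
  have h3 := h (0, 1, 0)
  have h4 := h (0, 0, 1)
  simp [torusForm_apply, lorentzForm_apply] at h0 h1 h2 h3 h4
  simp only [lorentzForm_apply]
  have hb : l * (u.2.1 - (R ^ 2 - 1) * u.2.2) = 0 := by
    linear_combination -2 * h4 - 2 * (R ^ 2 - 1) * h3
  by_cases l0 : l = 0
  · refine ⟨fun _ => Or.inl l0, fun hu => ?_⟩
    subst l0
    have : u.2.1 = -((R ^ 2 - 1) * u.2.2) := by linarith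
    rw [this] at hu
    nlinarith [sq_nonneg (u.1 0), sq_nonneg (u.1 1), sq_nonneg (u.1 2), sq_nonneg u.2.2,
      mul_nonneg hk.le (sq_nonneg u.2.2)]
  · have hz := h2.resolve_left l0
    have ha : u.2.1 = (R ^ 2 - 1) * u.2.2 :=
      sub_eq_zero.1 ((mul_eq_zero.1 hb).resolve_left l0)
    by_cases l1 : l = 4 * R ^ 2
    · refine ⟨fun _ => Or.inr l1, fun hu => ?_⟩
      rw [ha, l1] at h3
      have : u.2.2 = 0 := by linarith
      rw [ha, this, hz] at hu
      nlinarith [sq_nonneg (u.1 0), sq_nonneg (u.1 1)]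
    · have hx : u.1 0 = 0 := h0.resolve_left (Ne.symm l1)
      have hy : u.1 1 = 0 := h1.resolve_left (Ne.symm l1)
      refine ⟨fun hu => ?_, fun hu => ⟨?_, hx, hy, hz, ha⟩⟩
      · rw [hx, hy, hz, ha] at hu
        nlinarith [mul_nonneg hk.le (sq_nonneg u.2.2)]
      · have hb0 : u.2.2 ≠ 0 := by
          intro h0
          rw [hx, hy, hz, ha, h0] at hu
          simp at hu
        rw [ha] at h3
        apply mul_right_cancel₀ hb0
        linarith

theorem torusForm_symm (R : ℝ) (v w : LorentzSpace) : torusForm R v w = torusForm R w v := by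
  simp only [torusForm_apply]
  ring

/-- A Lorentz similarity preserving the torus preserves the torus form and the squared height up
to scale, except that for `R = √2` it may change the sign of the torus form. -/
theorem IsLorentzSimilarity.torusForm_torusHeight {R : ℝ} (hR : 1 < R)
    {L : LorentzSpace →ₗ[ℝ] LorentzSpace} {μ : ℝ} (hL : IsLorentzSimilarity L μ)
    (hT : ∀ v, lorentzForm v v = 0 → torusForm R v v = 0 → torusForm R (L v) (L v) = 0)
    {v : LorentzSpace} (hv : lorentzForm v v = 0) :
    torusHeight R (L v) ^ 2 = μ * torusHeight R v ^ 2 ∧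
      (torusForm R (L v) (L v) = μ * torusForm R v v ∨
        R ^ 2 = 2 ∧ torusForm R (L v) (L v) = -(μ * torusForm R v v)) := by
  have hpos : 0 < R ^ 2 - 1 := by nlinarith
  obtain ⟨k, hk⟩ : ∃ k, k = R ^ 2 - 1 := ⟨_, rfl⟩
  have hk0 : 0 < k := hk ▸ hpos
  obtain ⟨κ, hκ⟩ : ∃ κ, κ ^ 2 = k := ⟨√k, sq_sqrt hk0.le⟩
  have hκ0 : κ ≠ 0 := by
    rintro rfl
    simp at hκ
    linarith
  have hR0 : R ≠ 0 := by positivity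
  have hμ := hL.1
  -- A Lorentz-orthogonal eigenbasis, scaled so that `c F1 + s F2 + c' F3 + s' F4 + F5` is null and
  -- on the torus whenever `(c, s)` and `(c', s')` lie on the unit circle.
  set F1 : LorentzSpace := (!₂[k, 0, 0], 0, 0)
  set F2 : LorentzSpace := (!₂[0, k, 0], 0, 0)
  set F3 : LorentzSpace := (!₂[0, 0, κ], 0, 0)
  set F4 : LorentzSpace := (0, k, -1)
  set F5 : LorentzSpace := (0, R * k, R)
  have hdec : ∀ w : LorentzSpace, w = (w.1 0 / k) • F1 + (w.1 1 / k) • F2 + (w.1 2 / κ) • F3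
      + ((w.2.1 - k * w.2.2) / (2 * k)) • F4 + ((w.2.1 + k * w.2.2) / (2 * k * R)) • F5 := by
    intro w
    apply LorentzSpace.ext <;> simp [F1, F2, F3, F4, F5] <;> field_simp <;> ring
  obtain ⟨⟨h12, h13, h14, h15, h23, h24, h25, h34, h35, h45⟩, h1122, h3344, hsum⟩ :=
    quadratic_coeffs_of_vanishing_on_torus
      (g11 := torusForm R (L F1) (L F1)) (g12 := torusForm R (L F1) (L F2))
      (g13 := torusForm R (L F1) (L F3)) (g14 := torusForm R (L F1) (L F4))
      (g15 := torusForm R (L F1) (L F5)) (g22 := torusForm R (L F2) (L F2))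
      (g23 := torusForm R (L F2) (L F3)) (g24 := torusForm R (L F2) (L F4))
      (g25 := torusForm R (L F2) (L F5)) (g33 := torusForm R (L F3) (L F3))
      (g34 := torusForm R (L F3) (L F4)) (g35 := torusForm R (L F3) (L F5))
      (g44 := torusForm R (L F4) (L F4)) (g45 := torusForm R (L F4) (L F5))
      (g55 := torusForm R (L F5) (L F5)) (by
        intro c s c' s' hcs hcs'
        have := hT (c • F1 + s • F2 + c' • F3 + s' • F4 + F5)
          (by
            simp [lorentzForm_apply, F1, F2, F3, F4, F5]
            linear_combination k ^ 2 * hcs + c' ^ 2 * hκ + k * hcs' + k * hk)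
          (by
            simp [torusForm_apply, F1, F2, F3, F4, F5, ← hk]
            linear_combination 4 * k ^ 2 * R ^ 2 * hcs)
        simp only [map_add, map_smul, LinearMap.add_apply, LinearMap.smul_apply, smul_eq_mul,
          torusForm_symm R (L F2) (L F1), torusForm_symm R (L F3) (L F1),
          torusForm_symm R (L F4) (L F1), torusForm_symm R (L F5) (L F1),
          torusForm_symm R (L F3) (L F2), torusForm_symm R (L F4) (L F2),
          torusForm_symm R (L F5) (L F2), torusForm_symm R (L F4) (L F3),
          torusForm_symm R (L F5) (L F3), torusForm_symm R (L F5) (L F4)] at this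
        linear_combination this)
  have q11 : lorentzForm F1 F1 = k ^ 2 := by simp [lorentzForm_apply, F1]; ring
  have q33 : lorentzForm F3 F3 = k := by simp [lorentzForm_apply, F3, ← hκ]; ring
  have q55 : lorentzForm F5 F5 = -(R ^ 2 * k) := by simp [lorentzForm_apply, F5]; ring
  obtain ⟨l1, hl1⟩ : ∃ l, torusForm R (L F1) (L F1) = l * μ * k ^ 2 :=
    ⟨torusForm R (L F1) (L F1) / (μ * k ^ 2), by field_simp⟩
  obtain ⟨l3, hl3⟩ : ∃ l, torusForm R (L F3) (L F3) = l * μ * k :=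
    ⟨torusForm R (L F3) (L F3) / (μ * k), by field_simp⟩
  obtain ⟨l5, hl5⟩ : ∃ l, torusForm R (L F5) (L F5) = l * μ * -(R ^ 2 * k) :=
    ⟨torusForm R (L F5) (L F5) / (μ * -(R ^ 2 * k)), by field_simp⟩
  -- The images of the `Fi` are orthogonal for both forms, hence simultaneous eigenvectors; the sign
  -- of their Lorentz norm then restricts the eigenvalues.
  have e1 : ∀ w, torusForm R (L F1) w = l1 * lorentzForm (L F1) w := by
    intro w
    obtain ⟨w, rfl⟩ := hL.surjective w
    rw [hL.2, hdec w]
    simp only [map_add, map_smul, smul_eq_mul, h12, h13, h14, h15, hl1]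
    simp [lorentzForm_apply, F1, F2, F3, F4, F5]
    ring
  have e3 : ∀ w, torusForm R (L F3) w = l3 * lorentzForm (L F3) w := by
    intro w
    obtain ⟨w, rfl⟩ := hL.surjective w
    rw [hL.2, hdec w]
    simp only [map_add, map_smul, smul_eq_mul, torusForm_symm R (L F3) (L F1),
      torusForm_symm R (L F3) (L F2), h13, h23, h34, h35, hl3, ← hκ]
    simp [lorentzForm_apply, F1, F2, F3, F4, F5]
    ring
  have e5 : ∀ w, torusForm R (L F5) w = l5 * lorentzForm (L F5) w := by
    intro w
    obtain ⟨w, rfl⟩ := hL.surjective w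
    rw [hL.2, hdec w]
    simp only [map_add, map_smul, smul_eq_mul, torusForm_symm R (L F5) (L F1),
      torusForm_symm R (L F5) (L F2), torusForm_symm R (L F5) (L F3),
      torusForm_symm R (L F5) (L F4), h15, h25, h35, h45, hl5]
    simp [lorentzForm_apply, F1, F2, F3, F4, F5]
    ring
  have d1 := (torusForm_eigenvector hR e1).1 (by rw [hL.2, q11]; positivity)
  have d3 := (torusForm_eigenvector hR e3).1 (by rw [hL.2, q33]; positivity)
  obtain ⟨d5, x0, x1, x2, xb⟩ := (torusForm_eigenvector hR e5).2 (by
    rw [hL.2, q55]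
    have : 0 < μ * (R ^ 2 * k) := by positivity
    linarith)
  rw [← hk] at d5 xb
  constructor
  -- Pairing with `F5` is `-R/2` times the height, and `L F5` lies on the same timelike line, so `L`
  -- preserves the height up to scale and sign.
  · have n5 := hL.2 F5 F5
    rw [q55] at n5
    have nv := hL.2 v F5
    simp only [lorentzForm_apply, x0, x1, x2, xb] at n5 nv
    simp [F5] at nv
    simp only [torusHeight_apply, ← hk]
    set b := (L F5).2.2
    have hb2 : b ^ 2 = μ * R ^ 2 := by
      apply mul_left_cancel₀ hk0.ne'
      linear_combination -n5
    have hb0 : b ^ 2 ≠ 0 := by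
      rw [hb2]
      positivity
    have hlin : b * ((L v).2.1 + k * (L v).2.2) = μ * R * (v.2.1 + k * v.2.2) := by
      linear_combination 2 * nv
    apply mul_left_cancel₀ hb0
    linear_combination (b * ((L v).2.1 + k * (L v).2.2) + μ * R * (v.2.1 + k * v.2.2)) * hlin
      - μ * (v.2.1 + k * v.2.2) ^ 2 * hb2
  · have hsum' : k * l1 + l3 = R ^ 2 * l5 := by
      rw [hl1, hl3, hl5] at hsum
      apply mul_left_cancel₀ (mul_ne_zero hμ.ne' hk0.ne')
      linear_combination hsum
    have hQ : torusForm R (L v) (L v) = (v.1 0 ^ 2 + v.1 1 ^ 2) * (l1 * μ)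
        + (v.1 2 ^ 2 + (v.2.1 - k * v.2.2) ^ 2 / (4 * k)) * (l3 * μ)
        - μ * (v.2.1 + k * v.2.2) ^ 2 := by
      conv_lhs => rw [hdec v]
      simp only [map_add, map_smul, LinearMap.add_apply, LinearMap.smul_apply, smul_eq_mul,
          torusForm_symm R (L F2) (L F1), torusForm_symm R (L F3) (L F1),
          torusForm_symm R (L F4) (L F1), torusForm_symm R (L F5) (L F1),
          torusForm_symm R (L F3) (L F2), torusForm_symm R (L F4) (L F2),
          torusForm_symm R (L F5) (L F2), torusForm_symm R (L F4) (L F3),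
          torusForm_symm R (L F5) (L F3), torusForm_symm R (L F5) (L F4),
          h12, h13, h14, h15, h23, h24, h25, h34, h35, h45, ← h1122, ← h3344, hl1, hl3, hl5, d5]
      field_simp
      ring_nf
      simp only [hκ]
      ring
    rw [hQ]
    have hk4 : R ^ 2 = k + 1 := by linarith
    simp only [torusForm_apply, ← hk]
    rw [d5] at hsum'
    -- With `l5 = 4k`, the relation `k l1 + l3 = 4 k R²` leaves `(4R², 0)`, where the planes are
    -- fixed, and `(0, 4R²)`, where they are exchanged and `k = 1`.
    rcases d1 with rfl | rfl <;> rcases d3 with rfl | rfl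
    · exfalso
      have : 0 < R ^ 2 * (4 * k) := by positivity
      linarith
    · right
      have hk1 : k = 1 := by
        apply mul_left_cancel₀ (pow_ne_zero 2 hR0)
        linarith
      refine ⟨by linarith, ?_⟩
      simp only [lorentzForm_apply] at hv
      rw [hk4, hk1]
      linear_combination 8 * μ * hv
    · left
      ring
    · exfalso
      have : 0 < 4 * R ^ 2 := by positivity
      linarith

/-- Centres of homothetic inverted tori lie at the same level of the torus form, or, if `R = √2`,
at opposite levels. -/
theorem level_eq_of_shapeOf_eq {R : ℝ} (hR : 1 < R) {p q : E3} (hp : p ∉ torus R)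
    (hq : q ∉ torus R) (h : shapeOf (invertedTorus R p) = shapeOf (invertedTorus R q)) :
    torusForm R (nullLift p) (nullLift p) * torusHeight R (nullLift q) ^ 2 =
        torusForm R (nullLift q) (nullLift q) * torusHeight R (nullLift p) ^ 2 ∨
      R ^ 2 = 2 ∧ torusForm R (nullLift p) (nullLift p) * torusHeight R (nullLift q) ^ 2 =
        -torusForm R (nullLift q) (nullLift q) * torusHeight R (nullLift p) ^ 2 := by
  obtain ⟨f, hf⟩ := shapeOf_eq_iff.1 h
  obtain ⟨N, μ, hN, hNf, hNi⟩ := exists_lorentz_of_dilation f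
  set L := inversionMap q ∘ₗ N ∘ₗ inversionMap p with hLdef
  have hL := (isLorentzSimilarity_inversionMap q).comp
    (hN.comp (isLorentzSimilarity_inversionMap p))
  rw [mul_one, one_mul, ← hLdef] at hL
  have hLp : L (nullLift p) = μ • nullLift q := by
    simp [L, inversionMap_nullLift_self, hNi, inversionMap_nullInfty]
  have hT : ∀ v, lorentzForm v v = 0 → torusForm R v v = 0 → torusForm R (L v) (L v) = 0 := by
    intro v hv hQ
    by_cases hb : v.2.2 = 0
    -- The torus misses `∞`, so a null vector over `∞` satisfying the torus equation is zero.
    · have hv' := eq_smul_nullInfty hv hb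
      have h0 : v.2.1 = 0 := by
        rw [hv'] at hQ
        simpa [torusForm_apply, nullInfty] using hQ
      rw [hv', h0]
      simp
    · have hv' := eq_smul_nullLift hv hb
      set x := v.2.2⁻¹ • v.1
      rw [hv'] at hQ ⊢
      have hx : x ∈ torus R := by
        rw [mem_torus_iff hR]
        simpa [hb] using hQ
      have hxp : x ≠ p := fun hxp => hp (hxp ▸ hx)
      have hy : f (EuclideanGeometry.inversion p 1 x) ∈ invertedTorus R q :=
        hf ▸ mem_image_of_mem f (mem_image_of_mem _ hx)
      rw [mem_invertedTorus_iff hR hq] at hy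
      simp [L, inversionMap_nullLift p x hxp, hNf, hy]
  obtain ⟨hh, hF⟩ := hL.torusForm_torusHeight hR hT (lorentzForm_nullLift_self p)
  have hμ := hL.1.ne'
  simp only [hLp, map_smul, LinearMap.smul_apply, smul_eq_mul] at hh hF
  have hh' : μ * torusHeight R (nullLift q) ^ 2 = torusHeight R (nullLift p) ^ 2 := by
    apply mul_left_cancel₀ hμ
    linear_combination hh
  rw [← hh']
  rcases hF with hF | ⟨h2, hF⟩
  · left
    apply mul_left_cancel₀ hμ
    linear_combination -torusHeight R (nullLift q) ^ 2 * hF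
  · right
    refine ⟨h2, ?_⟩
    apply mul_left_cancel₀ hμ
    linear_combination torusHeight R (nullLift q) ^ 2 * hF

/-! ### Levels of centres on the `x`-axis -/

theorem torusForm_nullLift_axis (R ϱ : ℝ) :
    torusForm R (nullLift !₂[ϱ, 0, 0]) (nullLift !₂[ϱ, 0, 0]) =
      4 * R ^ 2 * ϱ ^ 2 - (ϱ ^ 2 + (R ^ 2 - 1)) ^ 2 := by
  simp [torusForm_apply, nullLift]
  ring

theorem torusHeight_nullLift_axis (R ϱ : ℝ) :
    torusHeight R (nullLift !₂[ϱ, 0, 0]) = ϱ ^ 2 + (R ^ 2 - 1) := by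
  simp [torusHeight_apply, nullLift]

theorem axis_notMem_torus {R ϱ : ℝ} (hR : 1 < R) (h0 : 0 ≤ ϱ) (h1 : ϱ ≠ R - 1)
    (h2 : ϱ ≠ R + 1) : !₂[ϱ, 0, 0] ∉ torus R := by
  rw [mem_torus_iff hR, torusForm_nullLift_axis]
  have hfac : 4 * R ^ 2 * ϱ ^ 2 - (ϱ ^ 2 + (R ^ 2 - 1)) ^ 2 =
      (ϱ - (R - 1)) * (R + 1 - ϱ) * ((ϱ + R - 1) * (ϱ + R + 1)) := by ring
  rw [hfac]
  have h3 : 0 < ϱ + R - 1 := by linarith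
  have h4 : 0 < ϱ + R + 1 := by linarith
  exact mul_ne_zero (mul_ne_zero (sub_ne_zero.2 h1) (sub_ne_zero.2 h2.symm)) (by positivity)

/-- The circle `𝒞(ϱ; R)` has equation `ϱ (ρ² + z² + R² - 1) = ρ (ϱ² + R² - 1)`, which says that `ρ /
height` is constant along it. -/
theorem level_of_mem_centerTorus {R ϱ : ℝ} {p : E3} (hp : p ∈ centerTorus R ϱ) :
    (p 0 ^ 2 + p 1 ^ 2) * (ϱ ^ 2 + (R ^ 2 - 1)) ^ 2 =
      ϱ ^ 2 * torusHeight R (nullLift p) ^ 2 := by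
  obtain ⟨q, hq, θ, -, rfl⟩ := hp
  have hθ : (q.1 * cos θ) ^ 2 + (q.1 * sin θ) ^ 2 = q.1 ^ 2 := by
    linear_combination q.1 ^ 2 * sin_sq_add_cos_sq θ
  simp [torusHeight_apply, nullLift]
  rw [hθ]
  unfold meridian at hq
  split_ifs at hq with h0
  · simp only [mem_ofPred_eq] at hq
    simp [hq, h0]
  · simp only [mem_ofPred_eq] at hq
    have : ϱ * (q.1 ^ 2 + q.2 ^ 2 + (R ^ 2 - 1)) = q.1 * (ϱ ^ 2 + (R ^ 2 - 1)) := by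
      field_simp at hq
      apply mul_left_cancel₀ (mul_ne_zero (four_ne_zero (α := ℝ)) h0)
      linear_combination hq
    rw [← mul_pow, ← mul_pow, this]

theorem shapeOf_of_mem_centerTorus {R ϱ : ℝ} (hR : 1 < R) (h0 : 0 ≤ ϱ) (h1 : ϱ ≠ R - 1)
    (h2 : ϱ ≠ R + 1) {p : E3} (hp : p ∈ centerTorus R ϱ) :
    shapeOf (invertedTorus R p) = invShape R ϱ := by
  have hq := axis_notMem_torus hR h0 h1 h2
  have hlev := level_of_mem_centerTorus hp
  have hF : torusForm R (nullLift p) (nullLift p) =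
      4 * R ^ 2 * (p 0 ^ 2 + p 1 ^ 2) - torusHeight R (nullLift p) ^ 2 := by
    simp only [torusForm_apply, torusHeight_apply, nullLift]
    ring
  have key : torusForm R (nullLift p) (nullLift p) *
        torusHeight R (nullLift !₂[ϱ, 0, 0]) ^ 2 =
      torusForm R (nullLift !₂[ϱ, 0, 0]) (nullLift !₂[ϱ, 0, 0]) *
        torusHeight R (nullLift p) ^ 2 := by
    rw [torusHeight_nullLift_axis, torusForm_nullLift_axis, hF]
    linear_combination 4 * R ^ 2 * hlev
  refine shapeOf_invertedTorus_eq_of_level hR (fun hpT => ?_) hq key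
  rw [mem_torus_iff hR] at hpT hq
  rw [hpT, zero_mul] at key
  exact mul_ne_zero hq (pow_ne_zero 2 (torusHeight_nullLift_pos hR p).ne') key.symm

theorem eq_of_axis_level_eq {R ϱ σ : ℝ} (hR : 1 < R) (hϱ0 : 0 ≤ ϱ) (hσ0 : 0 ≤ σ)
    (hϱ : ϱ ≤ √(R ^ 2 - 1)) (hσ : σ ≤ √(R ^ 2 - 1))
    (h : torusForm R (nullLift !₂[ϱ, 0, 0]) (nullLift !₂[ϱ, 0, 0]) *
        torusHeight R (nullLift !₂[σ, 0, 0]) ^ 2 =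
      torusForm R (nullLift !₂[σ, 0, 0]) (nullLift !₂[σ, 0, 0]) *
        torusHeight R (nullLift !₂[ϱ, 0, 0]) ^ 2) : ϱ = σ := by
  simp only [torusForm_nullLift_axis, torusHeight_nullLift_axis] at h
  have hpos : 0 < R ^ 2 - 1 := by nlinarith
  have hk : √(R ^ 2 - 1) ^ 2 = R ^ 2 - 1 := sq_sqrt hpos.le
  set κ := √(R ^ 2 - 1)
  rw [← hk] at h hpos
  have h1 : (ϱ * (σ ^ 2 + κ ^ 2)) ^ 2 = (σ * (ϱ ^ 2 + κ ^ 2)) ^ 2 := by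
    apply mul_left_cancel₀ (show 4 * R ^ 2 ≠ 0 by positivity)
    linear_combination h
  have h2 := (pow_left_inj₀ (by positivity) (by positivity) two_ne_zero).1 h1
  -- The other solution `ϱ σ = κ²` is the opposite end of the diameter of `𝒞(ϱ; R)`; below `κ` it
  -- occurs only for `ϱ = σ = κ`.
  have h3 : (ϱ - σ) * (κ ^ 2 - ϱ * σ) = 0 := by linear_combination h2
  rcases mul_eq_zero.1 h3 with h4 | h4
  · linarith
  · have hκ : 0 < κ := by
      rcases (sqrt_nonneg (R ^ 2 - 1)).lt_or_eq with h | h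
      · exact h
      · rw [show κ = 0 from h.symm] at hpos
        simp at hpos
    have e1 : κ ≤ ϱ := by nlinarith
    have e2 : κ ≤ σ := by nlinarith
    linarith

theorem sub_one_lt_sqrt {R : ℝ} (hR : 1 < R) : R - 1 < √(R ^ 2 - 1) :=
  lt_sqrt_of_sq_lt (by nlinarith)

theorem torusForm_axis_neg {R ϱ : ℝ} (h : ϱ ∈ Ico 0 (R - 1)) :
    torusForm R (nullLift !₂[ϱ, 0, 0]) (nullLift !₂[ϱ, 0, 0]) < 0 := by
  have hfac : 4 * R ^ 2 * ϱ ^ 2 - (ϱ ^ 2 + (R ^ 2 - 1)) ^ 2 =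
      -((R - 1 - ϱ) * (R + 1 - ϱ) * ((ϱ + R - 1) * (ϱ + R + 1))) := by ring
  rw [torusForm_nullLift_axis, hfac]
  have h1 : 0 < R - 1 - ϱ := by linarith [h.2]
  have h2 : 0 < R + 1 - ϱ := by linarith [h.2]
  have h3 : 0 < ϱ + R - 1 := by linarith [h.1, h.2]
  have h4 : 0 < ϱ + R + 1 := by linarith [h.1, h.2]
  have : 0 < (R - 1 - ϱ) * (R + 1 - ϱ) * ((ϱ + R - 1) * (ϱ + R + 1)) := by positivity
  linarith

theorem injOn_invShape {R : ℝ} (hR : 1 < R) : InjOn (invShape R) (Ico 0 (R - 1)) := by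
  intro ϱ hϱ σ hσ h
  have hlt := sub_one_lt_sqrt hR
  rcases level_eq_of_shapeOf_eq hR
    (axis_notMem_torus hR hϱ.1 hϱ.2.ne (by linarith [hϱ.2]))
    (axis_notMem_torus hR hσ.1 hσ.2.ne (by linarith [hσ.2])) h with h | ⟨-, h⟩
  · exact eq_of_axis_level_eq hR hϱ.1 hσ.1 (hϱ.2.le.trans hlt.le) (hσ.2.le.trans hlt.le) h
  -- Both levels are negative inside the hole, so they cannot be opposite.
  · have h1 := mul_neg_of_neg_of_pos (torusForm_axis_neg hϱ)
      (pow_pos (torusHeight_nullLift_pos hR !₂[σ, 0, 0]) 2)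
    have h2 := mul_neg_of_neg_of_pos (torusForm_axis_neg hσ)
      (pow_pos (torusHeight_nullLift_pos hR !₂[ϱ, 0, 0]) 2)
    linarith

theorem injOn_invShape_of_ne {R : ℝ} (hR : 1 < R) (h2 : R ≠ √2) :
    InjOn (invShape R) (Ico 0 (R - 1) ∪ Ioc (R - 1) √(R ^ 2 - 1)) := by
  have hlt := sub_one_lt_sqrt hR
  have hub : √(R ^ 2 - 1) < R + 1 := (sqrt_lt' (by linarith)).2 (by nlinarith)
  have hmem : ∀ ϱ ∈ Ico 0 (R - 1) ∪ Ioc (R - 1) √(R ^ 2 - 1),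
      0 ≤ ϱ ∧ ϱ ≤ √(R ^ 2 - 1) ∧ !₂[ϱ, 0, 0] ∉ torus R := by
    rintro ϱ (h | h)
    · exact ⟨h.1, h.2.le.trans hlt.le, axis_notMem_torus hR h.1 h.2.ne (by linarith [h.2])⟩
    · have h0 : 0 ≤ ϱ := by linarith [h.1]
      exact ⟨h0, h.2, axis_notMem_torus hR h0 h.1.ne' (by linarith [h.2])⟩
  intro ϱ hϱ σ hσ h
  obtain ⟨a1, a2, a3⟩ := hmem ϱ hϱ
  obtain ⟨b1, b2, b3⟩ := hmem σ hσ
  rcases level_eq_of_shapeOf_eq hR a3 b3 h with h | ⟨h, -⟩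
  · exact eq_of_axis_level_eq hR a1 b1 a2 b2 h
  · exact (h2 (by rw [← h, sqrt_sq (by linarith)])).elim

theorem exists_axis_level {s : ℝ} (h0 : 0 ≤ s) (h1 : s ≤ 1) :
    ∃ ϱ : ℝ, 0 ≤ ϱ ∧ ϱ ≤ 1 ∧ 4 * ϱ ^ 2 = s * (ϱ ^ 2 + 1) ^ 2 := by
  have hw : √(1 - s) ^ 2 = 1 - s := sq_sqrt (by linarith)
  have hv : √s ^ 2 = s := sq_sqrt h0
  have hw0 := sqrt_nonneg (1 - s)
  have hv1 : √s ≤ 1 := sqrt_le_one.2 h1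
  -- The half-angle formula: for `√s = sin α` with `α` in `[0, π/2]`, the witness is `tan (α / 2)`,
  -- and `2ϱ / (ϱ² + 1) = sin α`.
  refine ⟨√s / (1 + √(1 - s)), by positivity, (div_le_one (by positivity)).2 (by linarith), ?_⟩
  have hsum : (√s / (1 + √(1 - s))) ^ 2 + 1 = 2 / (1 + √(1 - s)) := by
    field_simp
    linear_combination hv + hw
  rw [hsum, div_pow, div_pow, hv]
  ring

/-- Every inverted `T_{√2}` has the shape of one inverted in a point of the `x`-axis inside the
hole. -/
theorem exists_invShape_eq {p : E3} (hp : p ∉ torus √2) :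
    ∃ ϱ ∈ Ico 0 (√2 - 1), shapeOf (invertedTorus √2 p) = invShape √2 ϱ := by
  have hR : 1 < √2 := one_lt_sqrt_two
  have h2 : √2 ^ 2 = 2 := sq_sqrt zero_le_two
  have he := torusHeight_nullLift_pos hR p
  have hF : torusForm √2 (nullLift p) (nullLift p) =
      8 * (p 0 ^ 2 + p 1 ^ 2) - torusHeight √2 (nullLift p) ^ 2 := by
    simp only [torusForm_apply, torusHeight_apply, nullLift, h2]
    ring
  -- This is `2ρ ≤ ρ² + z² + 1`, squared. It places `t = 4ρ² / height²` in `[0, 1]`; the level is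
  -- `2t - 1`, and the swap acts by `t ↦ 1 - t`.
  have hle : 4 * (p 0 ^ 2 + p 1 ^ 2) ≤ torusHeight √2 (nullLift p) ^ 2 := by
    simp only [torusHeight_apply, nullLift, h2]
    nlinarith [sq_nonneg (p 0 ^ 2 + p 1 ^ 2 - 1), sq_nonneg (p 2), sq_nonneg (p 0),
      sq_nonneg (p 1), mul_nonneg (sq_nonneg (p 2)) (sq_nonneg (p 0)),
      mul_nonneg (sq_nonneg (p 2)) (sq_nonneg (p 1)), sq_nonneg (p 2 ^ 2)]
  have hne : torusForm √2 (nullLift p) (nullLift p) ≠ 0 := fun h => hp ((mem_torus_iff hR p).2 h)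
  obtain ⟨t, ht⟩ : ∃ t, t * torusHeight √2 (nullLift p) ^ 2 = 4 * (p 0 ^ 2 + p 1 ^ 2) :=
    ⟨4 * (p 0 ^ 2 + p 1 ^ 2) / torusHeight √2 (nullLift p) ^ 2, by field_simp⟩
  set e := torusHeight √2 (nullLift p)
  have he2 : 0 < e ^ 2 := by positivity
  have ht0 : 0 ≤ t := by
    refine le_of_mul_le_mul_right ?_ he2
    rw [ht]
    nlinarith [sq_nonneg (p 0), sq_nonneg (p 1)]
  have ht1 : t ≤ 1 := le_of_mul_le_mul_right (by linarith) he2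
  have hF' : torusForm √2 (nullLift p) (nullLift p) = (2 * t - 1) * e ^ 2 := by
    rw [hF]
    linear_combination -2 * ht
  have hthalf : 2 * t - 1 ≠ 0 := fun h => hne (by rw [hF', h, zero_mul])
  have hmain : ∀ s, 0 ≤ s → 2 * s < 1 → (s = t ∨ s = 1 - t) →
      ∃ ϱ ∈ Ico 0 (√2 - 1), shapeOf (invertedTorus √2 p) = invShape √2 ϱ := by
    intro s hs0 hs1 hst
    obtain ⟨ϱ, h0, h1, hs⟩ := exists_axis_level hs0 (by linarith)
    have hlt : ϱ < √2 - 1 := by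
      have ha : 8 * ϱ ^ 2 < (ϱ ^ 2 + 1) ^ 2 := by
        have : 0 < (ϱ ^ 2 + 1) ^ 2 := by positivity
        nlinarith
      have hb : 2 * √2 * ϱ < ϱ ^ 2 + 1 := by
        refine lt_of_pow_lt_pow_left₀ 2 (by positivity) ?_
        rw [mul_pow, mul_pow, h2]
        linarith
      nlinarith
    have hq := axis_notMem_torus hR h0 hlt.ne (by linarith)
    have hQ : torusForm √2 (nullLift !₂[ϱ, 0, 0]) (nullLift !₂[ϱ, 0, 0]) =
        (2 * s - 1) * torusHeight √2 (nullLift !₂[ϱ, 0, 0]) ^ 2 := by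
      rw [torusForm_nullLift_axis, torusHeight_nullLift_axis, h2]
      linear_combination 2 * hs
    refine ⟨ϱ, ⟨h0, hlt⟩, ?_⟩
    rcases hst with rfl | rfl
    · refine shapeOf_invertedTorus_eq_of_level hR hp hq ?_
      rw [hF', hQ]
      ring
    · refine shapeOf_invertedTorus_eq_of_opposite_level hp hq ?_
      rw [hF', hQ]
      ring
  rcases lt_or_gt_of_ne hthalf with h | h
  · exact hmain t ht0 (by linarith) (Or.inl rfl)
  · exact hmain (1 - t) (by linarith) (by linarith) (Or.inr rfl)

/-! ### The Möbius group -/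

/-- The null vector over a point of `ℝ³ ∪ {∞}`. -/
def extNullLift : OnePoint E3 → LorentzSpace
  | none => nullInfty
  | some x => nullLift x

theorem extNullLift_infty : extNullLift (OnePoint.infty) = nullInfty := rfl

theorem extNullLift_coe (x : E3) : extNullLift (x : OnePoint E3) = nullLift x := rfl

/-- Möbius transformations act on null vectors by Lorentz similarities. -/
theorem exists_lorentz_of_mem_mobiusGroup {g : Equiv.Perm (OnePoint E3)} (hg : g ∈ mobiusGroup) :
    ∃ L μ, IsLorentzSimilarity L μ ∧
      ∀ P, ∃ m : ℝ, m ≠ 0 ∧ L (extNullLift P) = m • extNullLift (g P) := by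
  induction hg using Subgroup.closure_induction with
  | mem g hg =>
    rcases hg with ⟨f, rfl⟩ | ⟨p, rfl⟩
    · obtain ⟨L, μ, hL, hf, hi⟩ := exists_lorentz_of_dilation f
      refine ⟨L, μ, hL, fun P => ?_⟩
      induction P using OnePoint.rec with
      | infty => exact ⟨μ, hL.1.ne', hi⟩
      | coe x => exact ⟨1, one_ne_zero, by rw [one_smul]; exact hf x⟩
    · refine ⟨inversionMap p, 1, isLorentzSimilarity_inversionMap p, fun P => ?_⟩
      induction P using OnePoint.rec with
      | infty => exact ⟨1, one_ne_zero, by rw [one_smul]; exact inversionMap_nullInfty p⟩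
      | coe x =>
        by_cases h : x = p
        · refine ⟨1, one_ne_zero, ?_⟩
          have : extInversion p (x : OnePoint E3) = OnePoint.infty := if_pos h
          rw [this, one_smul, extNullLift_infty, extNullLift_coe, h, inversionMap_nullLift_self]
        · refine ⟨dist x p ^ 2, pow_ne_zero 2 (dist_ne_zero.2 h), ?_⟩
          have : extInversion p (x : OnePoint E3) =
            (EuclideanGeometry.inversion p 1 x : E3) := if_neg h
          rw [this, extNullLift_coe, extNullLift_coe, inversionMap_nullLift p x h]
  | one =>
    exact ⟨LinearMap.id, 1, ⟨one_pos, fun v w => by simp⟩, fun P => ⟨1, one_ne_zero, by simp⟩⟩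
  | mul g h _ _ ihg ihh =>
    obtain ⟨L, μ, hL, hg⟩ := ihg
    obtain ⟨M, ν, hM, hh⟩ := ihh
    refine ⟨L ∘ₗ M, μ * ν, hL.comp hM, fun P => ?_⟩
    obtain ⟨m, hm, h1⟩ := hh P
    obtain ⟨n, hn, h2⟩ := hg (h P)
    exact ⟨m * n, mul_ne_zero hm hn, by simp [h1, h2, smul_smul]⟩
  | inv g _ ih =>
    obtain ⟨L, μ, hL, hg⟩ := ih
    let e := LinearEquiv.ofBijective L ⟨hL.injective, hL.surjective⟩
    have he : ∀ v, L (e.symm v) = v := fun v => LinearEquiv.apply_symm_apply e v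
    refine ⟨e.symm.toLinearMap, μ⁻¹, ⟨inv_pos.2 hL.1, fun v w => ?_⟩, fun P => ?_⟩
    · have := hL.2 (e.symm v) (e.symm w)
      rw [he, he] at this
      have hμ := hL.1.ne'
      simp only [LinearEquiv.coe_coe, this]
      field_simp
    · obtain ⟨m, hm, h⟩ := hg (g⁻¹ P)
      refine ⟨m⁻¹, inv_ne_zero hm, hL.injective ?_⟩
      rw [map_smul, h, LinearEquiv.coe_coe, he, smul_smul, inv_mul_cancel₀ hm, one_smul,
        ← Equiv.Perm.mul_apply, mul_inv_cancel, Equiv.Perm.one_apply]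

theorem extNullLift_injective_of_smul {P : OnePoint E3} {y : E3} {m : ℝ}
    (h : m • extNullLift P = nullLift y) : P = y := by
  induction P using OnePoint.rec with
  | infty =>
    have := congrArg (fun v => v.2.2) h
    simp [extNullLift_infty, nullInfty, nullLift] at this
  | coe x =>
    rw [extNullLift_coe] at h
    rw [nullLift_injective_of_smul h.symm]

/-- Möbius transformations fixing `∞` are similarities. -/
theorem exists_dilation_of_mem_mobiusGroup {g : Equiv.Perm (OnePoint E3)} (hg : g ∈ mobiusGroup)
    (hi : g OnePoint.infty = OnePoint.infty) : ∃ f : E3 ≃ᵈ E3, ∀ x : E3, g x = f x := by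
  obtain ⟨L, μ, hL, h⟩ := exists_lorentz_of_mem_mobiusGroup hg
  obtain ⟨m, -, hm⟩ := h OnePoint.infty
  rw [hi] at hm
  obtain ⟨f, c, hc, hf⟩ := hL.exists_dilation hm
  refine ⟨f, fun x => ?_⟩
  obtain ⟨n, -, hx⟩ := h x
  rw [extNullLift_coe, hf] at hx
  refine extNullLift_injective_of_smul (m := c⁻¹ * n) ?_
  rw [← smul_smul, ← hx, smul_smul, inv_mul_cancel₀ hc, one_smul]

theorem coe_image_invertedTorus {R : ℝ} {p : E3} (hp : p ∉ torus R) :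
    ((↑) : E3 → OnePoint E3) '' invertedTorus R p =
      extInversion p '' (((↑) : E3 → OnePoint E3) '' torus R) := by
  rw [invertedTorus, image_image, image_image]
  refine image_congr fun x hx => ?_
  have h : x ≠ p := fun h => hp (h ▸ hx)
  exact (if_neg h).symm

theorem shapeOf_eq_of_mobius {g : Equiv.Perm (OnePoint E3)} (hg : g ∈ mobiusGroup)
    (hi : g OnePoint.infty = OnePoint.infty) {S S' : Set E3}
    (h : ((↑) : E3 → OnePoint E3) '' S' = g '' (((↑) : E3 → OnePoint E3) '' S)) :
    shapeOf S = shapeOf S' := by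
  obtain ⟨f, hf⟩ := exists_dilation_of_mem_mobiusGroup hg hi
  refine shapeOf_eq_iff.2 ⟨f, ?_⟩
  apply OnePoint.coe_injective.image_injective
  rw [h, image_image, image_image]
  exact image_congr fun x _ => (hf x).symm

/-- Inversion in the unit sphere at the origin exchanges `a` and `b`, which preserves the height `a
+ b` when `R² - 1 = 1`. So `T_{√2}` is its own inverse, and similar copies of it contribute no new
shape. -/
theorem shapeOf_torus_sqrt_two : shapeOf (torus √2) = invShape √2 0 := by
  have hR : 1 < √2 := one_lt_sqrt_two
  have h2 : √2 ^ 2 = 2 := sq_sqrt zero_le_two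
  have h0 : !₂[(0 : ℝ), 0, 0] ∉ torus √2 :=
    axis_notMem_torus hR le_rfl (by linarith) (by linarith)
  rw [invShape]
  congr 1
  ext x
  rw [mem_torus_iff hR, mem_invertedTorus_iff hR h0]
  simp [torusForm_apply, nullLift, inversionMap]
  ring_nf

theorem mobiusShapeSpace_sqrt_two_subset {s : Shape} (hs : s ∈ mobiusShapeSpace √2) :
    ∃ p ∉ torus √2, s = shapeOf (invertedTorus √2 p) := by
  obtain ⟨g, hg, S, hS, rfl⟩ := hs
  have hinv : ∀ P, g P = OnePoint.infty → ∀ x ∈ torus √2, (x : OnePoint E3) ≠ P := by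
    rintro P hP x hx rfl
    have : g x ∈ ((↑) : E3 → OnePoint E3) '' S := hS ▸ mem_image_of_mem g (mem_image_of_mem _ hx)
    rw [hP] at this
    obtain ⟨y, -, hy⟩ := this
    exact OnePoint.coe_ne_infty y hy
  -- The point sent to `∞` decides the shape: a finite `p` makes `g` the inversion at `p` followed
  -- by a similarity, while `∞` makes `g` itself a similarity.
  obtain ⟨P, hP⟩ := g.surjective OnePoint.infty
  induction P using OnePoint.rec with
  | infty =>
    refine ⟨!₂[0, 0, 0], axis_notMem_torus one_lt_sqrt_two le_rfl ?_ ?_, ?_⟩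
    · linarith [one_lt_sqrt_two]
    · linarith [one_lt_sqrt_two]
    · rw [← shapeOf_eq_of_mobius hg hP hS]
      exact shapeOf_torus_sqrt_two
  | coe p =>
    have hp : p ∉ torus √2 := fun h => hinv p hP p h rfl
    refine ⟨p, hp, (shapeOf_eq_of_mobius (g := g * (extInversion p)⁻¹) ?_ ?_ ?_).symm⟩
    · exact mul_mem hg (inv_mem (Subgroup.subset_closure (Or.inr ⟨p, rfl⟩)))
    · have : (extInversion p)⁻¹ OnePoint.infty = p := by
        rw [Equiv.Perm.inv_eq_iff_eq]
        exact (if_pos rfl).symm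
      rw [Equiv.Perm.mul_apply, this, hP]
    · rw [hS, coe_image_invertedTorus hp, ← image_comp, ← image_comp, ← image_comp]
      refine image_congr fun x _ => ?_
      simp

end

theorem mainTheorem2 :
    (∀ R : ℝ, 1 < R →
      -- all centers on `𝒯(ϱ; R)` give one and the same shape, namely `i_ϱ(T_R)`
      (∀ ϱ : ℝ, 0 ≤ ϱ → ϱ ≠ R - 1 → ϱ ≠ R + 1 →
        ∀ p ∈ centerTorus R ϱ, shapeOf (invertedTorus R p) = invShape R ϱ) ∧
      Set.InjOn (invShape R) (Set.Ico 0 (R - 1)) ∧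
      (R ≠ √2 →
        Set.InjOn (invShape R) (Set.Ico 0 (R - 1) ∪ Set.Ioc (R - 1) √(R ^ 2 - 1)))) ∧
    (∀ ϱ : ℝ, √2 - 1 < ϱ → ϱ ≠ √2 + 1 →
      invShape √2 ϱ ∈ invShape √2 '' Set.Ico 0 (√2 - 1)) ∧
    Set.BijOn (invShape √2) (Set.Ico 0 (√2 - 1)) (inversionShapeSpace √2) ∧
    Set.BijOn (invShape √2) (Set.Ico 0 (√2 - 1)) (mobiusShapeSpace √2) := by
  have h1 : 1 < √2 := one_lt_sqrt_two
  have hax : ∀ ϱ ∈ Ico 0 (√2 - 1), !₂[ϱ, 0, 0] ∉ torus √2 := fun ϱ h =>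
    axis_notMem_torus h1 h.1 h.2.ne (by linarith [h.2])
  have hinj := injOn_invShape h1
  refine ⟨fun R hR => ⟨fun ϱ h0 ha hb p hp => shapeOf_of_mem_centerTorus hR h0 ha hb hp,
    injOn_invShape hR, injOn_invShape_of_ne hR⟩, ?_, ⟨?_, hinj, ?_⟩, ⟨?_, hinj, ?_⟩⟩
  · intro ϱ ha hb
    obtain ⟨σ, hσ, h⟩ := exists_invShape_eq (axis_notMem_torus h1 (by linarith) ha.ne' hb)
    exact ⟨σ, hσ, h.symm⟩
  · exact fun ϱ h => ⟨_, hax ϱ h, rfl⟩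
  · rintro s ⟨p, hp, rfl⟩
    obtain ⟨σ, hσ, h⟩ := exists_invShape_eq hp
    exact ⟨σ, hσ, h.symm⟩
  · exact fun ϱ h => ⟨_, Subgroup.subset_closure (Or.inr ⟨_, rfl⟩), _,
      coe_image_invertedTorus (hax ϱ h), rfl⟩
  · intro s hs
    obtain ⟨p, hp, rfl⟩ := mobiusShapeSpace_sqrt_two_subset hs
    obtain ⟨σ, hσ, h⟩ := exists_invShape_eq hp
    exact ⟨σ, hσ, h.symm⟩
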